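/- Let $m\ge 2$ and let $V_m=\{v_0<v_1<\dots<v_{m-1}\}$, $v_0=0$, $v_{m-1}=1$, be a chain of $m$ truth values with the Gödel implication $$v_p\Rightarrow v_q=\begin{cases}v_{m-1},& p\le q,\\ v_q,& p>q.\end{cases}$$ For $n\ge 1$ and $0\le j\le m-1$ let $g_n^{(j)}$ be the total number of occurrences of the value $v_j$ in the output columns of the truth tables of all full bracketings of $p_1\Rightarrow p_2\Rightarrow\cdots\Rightarrow p_n$ (with $p_1,\dots,p_n$ distinct variables), taken over all $m^n$ valuations $\{p_1,\dots,p_n\}\to V_m$, and let $g_n=\sum_{j=0}^{m-1}g_n^{(j)}$ be the total number of output entries. Then $g_n=m^nC_{n-1}$ for every $n\ge1$, where $C_k$ is the $k$-th Catalan number; the limit $$p_\bot(m):=\lim_{n\to\infty}\frac{g_n^{(0)}}{g_n}$$ exists; and $$p_\bot(m)=\frac12\left(1-\sqrt{\frac{m}{m+4}}\right)=1-\partial_v\Psi_r\!\left(\tfrac12\right),\qquad r=\frac1{4m},\quad \Psi_x(v)=\frac{1+v-\sqrt{(1-v)^2+4x}}{2},$$ where $\Psi_r$ is differentiable at $\tfrac12$.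 In particular, $p_\bot(m)\sim\frac1m$ as $m\to\infty$, and so $p_\bot(m)\to0$. -/

import Mathlib

namespace GodelChain

/-- Gödel implication on the chain `v_0 < v_1 < ⋯ < v_{m-1}`, where `v_j` is `j : Fin m`:
`v_p ⇒ v_q` is the top value `v_{m-1}` if `p ≤ q`, and `v_q` if `p > q`. -/
def godelImp {m : ℕ} (p q : Fin m) : Fin m :=
  if p ≤ q then ⟨m - 1, Nat.sub_lt p.pos Nat.one_pos⟩ else q

/-- The full bracketings of `p_1 ⇒ p_2 ⇒ ⋯ ⇒ p_n`, as the binary trees with `n` leaves. The `i`-th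
leaf from the left is the variable `p_i` and every inner node is an implication.
There are none for `n = 0`. -/
def fullBracketings : ℕ → Finset (BinaryTree Unit)
  | 0 => ∅
  | n + 1 => BinaryTree.treesOfNumNodesEq n

theorem mem_fullBracketings (t : BinaryTree Unit) (n : ℕ) :
    t ∈ fullBracketings n ↔ t.numLeaves = n := by
  have h := t.numLeaves_eq_numNodes_succ
  cases n with
  | zero => simp [fullBracketings, h]
  | succ n => simp [fullBracketings, h, BinaryTree.mem_treesOfNumNodesEq]

/-- The truth value of a bracketing under a valuation of its variables, which are numbered from
left to right. -/
def eval {m : ℕ} : (t : BinaryTree Unit) → (Fin t.numLeaves → Fin m) → Fin m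
  | .nil, ν => ν ⟨0, Nat.one_pos⟩
  | .node _ l r, ν =>
      godelImp (eval l fun i => ν (Fin.castAdd r.numLeaves i))
        (eval r fun i => ν (Fin.natAdd l.numLeaves i))

/-- `g_n^{(j)}`: the number of occurrences of the value `v_j` in the output columns of the truth
tables of all full bracketings of `p_1 ⇒ ⋯ ⇒ p_n`, over all valuations in the `m`-chain. -/
def outputCount (m n j : ℕ) : ℕ :=
  ∑ t ∈ fullBracketings n,
    (Finset.univ.filter fun ν : Fin t.numLeaves → Fin m => (eval t ν : ℕ) = j).card

/-- `g_n = ∑_{j < m} g_n^{(j)}`: the total number of output entries. -/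
def totalCount (m n : ℕ) : ℕ :=
  ∑ j ∈ Finset.range m, outputCount m n j

/-- `g_n^{(0)} / g_n`: the proportion of output entries equal to the bottom value `v_0`. -/
noncomputable def bottomRatio (m n : ℕ) : ℝ :=
  (outputCount m n 0 : ℝ) / (totalCount m n : ℝ)

/-- `p_⊥(m) = lim_{n → ∞} g_n^{(0)} / g_n`. -/
noncomputable def pBot (m : ℕ) : ℝ :=
  Filter.limUnder Filter.atTop (bottomRatio m)

/-- `Ψ_x(v) = (1 + v - √((1 - v)² + 4x)) / 2`. -/
noncomputable def psi (x v : ℝ) : ℝ :=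
  (1 + v - √((1 - v) ^ 2 + 4 * x)) / 2

end GodelChain

open Filter Topology Finset

/-! An implication is `0` exactly when its left side is nonzero and its right side is `0`. Let `a n
= catalan n / 4 ^ (n + 1)` and let `f n` be the count of zeros for `n + 1` variables over `(4 m) ^
(n + 1)`. Then `f` satisfies a convolution recurrence with factors `f` and `a - f`, and the wanted
ratio is `f / a`. Since `∑ a = 1/2` and `a (n + 1) / a n → 1`, only the two ends of the convolution
matter. If `f ~ L a` and `Φ = ∑ f`, the ends give `L = Φ (1 - L) + (1/2 - Φ) L`. Convergence itself
is a contraction: the relative error is multiplied by about `∑ |a - 2 f| ≤ 1/2`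
(`eventually_abs_sub_le_of_convolution`). Summing the recurrence gives a quadratic for `Φ`, hence
`L`. -/

/-! ### Asymptotics of convolution recurrences -/

theorem Finset.sum_range_succ_eq_sum_ends_add_middle {M : Type*} [AddCommMonoid M] (h : ℕ → M)
    {K N : ℕ} (hK : 2 * K ≤ N) :
    ∑ k ∈ range (N + 1), h k =
      (∑ k ∈ range K, h k) + (∑ k ∈ Ico K (N + 1 - K), h k) + ∑ k ∈ range K, h (N - k) := by
  have h1 := Finset.sum_range_add_sum_Ico h (show K ≤ N + 1 - K by omega)
  have h2 := Finset.sum_range_add_sum_Ico h (show N + 1 - K ≤ N + 1 by omega)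
  have h3 : ∑ k ∈ Ico (N + 1 - K) (N + 1), h k = ∑ k ∈ range K, h (N - k) := by
    symm
    refine Finset.sum_bij (fun k _ => N - k) ?_ ?_ ?_ ?_
    · intro k hk
      simp only [mem_range, mem_Ico] at *
      omega
    · intro k hk l hl hkl
      simp only [mem_range] at *
      omega
    · intro k hk
      simp only [mem_Ico] at hk
      exact ⟨N - k, by simp only [mem_range]; omega, by omega⟩
    · intro k _
      rfl
  rw [← h2, ← h1, h3]

theorem tendsto_div_add_of_tendsto_succ_div {a : ℕ → ℝ} (ha : ∀ n, 0 < a n)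
    (hr : Tendsto (fun n => a (n + 1) / a n) atTop (𝓝 1)) (k : ℕ) :
    Tendsto (fun n => a n / a (n + k)) atTop (𝓝 1) := by
  induction k with
  | zero =>
    have : (fun n => a n / a (n + 0)) = fun _ => (1 : ℝ) := by
      funext n
      exact div_self (ha n).ne'
    rw [this]
    exact tendsto_const_nhds
  | succ k ih =>
    have h1 := ih.mul (((tendsto_add_atTop_iff_nat k).2 hr).inv₀ one_ne_zero)
    rw [inv_one, mul_one] at h1
    refine h1.congr fun n => ?_
    have := (ha (n + k)).ne'
    have := (ha (n + k + 1)).ne'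
    rw [← add_assoc]
    field_simp

theorem tendsto_sub_div_succ_of_tendsto_succ_div {a : ℕ → ℝ} (ha : ∀ n, 0 < a n)
    (hr : Tendsto (fun n => a (n + 1) / a n) atTop (𝓝 1)) (k : ℕ) :
    Tendsto (fun n => a (n - k) / a (n + 1)) atTop (𝓝 1) := by
  refine ((tendsto_div_add_of_tendsto_succ_div ha hr (k + 1)).comp
    (tendsto_sub_atTop_nat k)).congr' ?_
  filter_upwards [eventually_ge_atTop k] with n hn
  simp only [Function.comp]
  rw [show n - k + (k + 1) = n + 1 by omega]

/-- A nonnegative solution `f ≤ a` of `f = f₀ + z f (a - f)` differs from `L a` by a sequence whose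
relative size contracts. -/
theorem eventually_abs_sub_le_of_convolution {a f : ℕ → ℝ} {L Φ δ : ℝ} (ha : ∀ n, 0 < a n)
    (hf : ∀ n, 0 ≤ f n) (hfa : ∀ n, f n ≤ a n)
    (hr : Tendsto (fun n => a (n + 1) / a n) atTop (𝓝 1))
    (hsa : HasSum a (1 / 2)) (hsf : HasSum f Φ)
    (hca : ∀ n, a (n + 1) = ∑ k ∈ range (n + 1), a k * a (n - k))
    (hcf : ∀ n, f (n + 1) = ∑ k ∈ range (n + 1), f k * (a (n - k) - f (n - k)))
    (hL : L = Φ + L * (1 / 2 - 2 * Φ)) (hδ : 0 < δ)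
    (h : ∀ᶠ n in atTop, |f n - L * a n| ≤ δ * a n) :
    ∀ᶠ n in atTop, |f n - L * a n| ≤ 3 / 4 * δ * a n := by
  have hx : Tendsto (fun K => ∑ k ∈ range K, (f k + L * (a k - 2 * f k))) atTop (𝓝 L) := by
    have := (hsf.add ((hsa.sub (hsf.mul_left 2)).mul_left L)).tendsto_sum_nat
    rwa [← hL] at this
  have hy := hsa.tendsto_sum_nat
  -- The contributions to the new error are `δ/16` from the main term, `9δ/16` from the old error
  -- and `1 - 2Y < δ/32` from the middle block, in total below `3δ/4`.
  obtain ⟨K, hKx, hKy⟩ := ((hx.eventually (Metric.ball_mem_nhds L (show 0 < δ / 16 by positivity))).and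
    (hy.eventually (lt_mem_nhds (show 1 / 2 - δ / 64 < 1 / 2 by linarith)))).exists
  have hKy' : ∑ k ∈ range K, a k ≤ 1 / 2 := sum_le_hasSum _ (fun k _ => (ha k).le) hsa
  have hX : Tendsto (fun N => ∑ k ∈ range K, (f k + L * (a k - 2 * f k)) * (a (N - k) / a (N + 1)))
      atTop (𝓝 (∑ k ∈ range K, (f k + L * (a k - 2 * f k)))) := by
    refine tendsto_finsetSum _ fun k _ => ?_
    simpa using (tendsto_sub_div_succ_of_tendsto_succ_div ha hr k).const_mul
      (f k + L * (a k - 2 * f k))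
  have hY : Tendsto (fun N => ∑ k ∈ range K, a k * (a (N - k) / a (N + 1)))
      atTop (𝓝 (∑ k ∈ range K, a k)) := by
    refine tendsto_finsetSum _ fun k _ => ?_
    simpa using (tendsto_sub_div_succ_of_tendsto_succ_div ha hr k).const_mul (a k)
  have hE : ∀ᶠ N in atTop, ∀ k ∈ range K, |f (N - k) - L * a (N - k)| ≤ δ * a (N - k) := by
    rw [Filter.eventually_all_finset]
    intro k _
    exact (tendsto_sub_atTop_nat k).eventually h
  rw [← map_add_atTop_eq_nat 1, eventually_map]
  filter_upwards [hX.eventually (Metric.isOpen_ball.mem_nhds hKx), hY.eventually (lt_mem_nhds hKy),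
    hY.eventually (gt_mem_nhds (show _ < (9 / 16 : ℝ) by linarith)), hE,
    eventually_ge_atTop (2 * K)] with N h1 h2 h3 h4 h5
  have hp := ha (N + 1)
  rw [Real.dist_eq] at h1
  set X := ∑ k ∈ range K, (f k + L * (a k - 2 * f k)) * (a (N - k) / a (N + 1)) with hXd
  set Y := ∑ k ∈ range K, a k * (a (N - k) / a (N + 1)) with hYd
  have hX' : X * a (N + 1) = ∑ k ∈ range K, (f k + L * (a k - 2 * f k)) * a (N - k) := by
    rw [hXd, sum_mul]
    refine sum_congr rfl fun k _ => ?_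
    field_simp
  have hY' : Y * a (N + 1) = ∑ k ∈ range K, a k * a (N - k) := by
    rw [hYd, sum_mul]
    refine sum_congr rfl fun k _ => ?_
    field_simp
  have hNk : ∀ k ∈ range K, N - (N - k) = k := by
    intro k hk
    rw [mem_range] at hk
    omega
  have hsplita := hca N
  rw [sum_range_succ_eq_sum_ends_add_middle _ h5, sum_congr (rfl : range K = range K)
    (fun k hk => show a (N - k) * a (N - (N - k)) = a k * a (N - k) by
      rw [hNk k hk, mul_comm]), ← hY'] at hsplita
  have hsplitf := hcf N
  rw [sum_range_succ_eq_sum_ends_add_middle _ h5] at hsplitf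
  -- Pairing `k` with `N - k` and writing `f (N - k)` as `L * a (N - k)` plus an error separates the
  -- main term from the propagated error.
  have hends : (∑ k ∈ range K, f k * (a (N - k) - f (N - k))) +
      ∑ k ∈ range K, f (N - k) * (a (N - (N - k)) - f (N - (N - k))) =
      X * a (N + 1) + ∑ k ∈ range K, (a k - 2 * f k) * (f (N - k) - L * a (N - k)) := by
    rw [hX', ← sum_add_distrib, ← sum_add_distrib]
    refine sum_congr rfl fun k hk => ?_
    rw [hNk k hk]
    ring
  have herr : |∑ k ∈ range K, (a k - 2 * f k) * (f (N - k) - L * a (N - k))| ≤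
      δ * (Y * a (N + 1)) := by
    rw [hY', mul_sum]
    refine (abs_sum_le_sum_abs _ _).trans (sum_le_sum fun k hk => ?_)
    rw [abs_mul]
    have h6 : |a k - 2 * f k| ≤ a k := by
      rw [abs_le]
      constructor <;> linarith [hf k, hfa k]
    calc |a k - 2 * f k| * |f (N - k) - L * a (N - k)| ≤ a k * (δ * a (N - k)) :=
          mul_le_mul h6 (h4 k hk) (abs_nonneg _) (ha k).le
      _ = δ * (a k * a (N - k)) := by ring
  -- The middle block of `f` is dominated by that of `a`, which is small because the ends of `a`
  -- already carry almost all of `a (N + 1)`.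
  have hmid0 : 0 ≤ ∑ k ∈ Ico K (N + 1 - K), f k * (a (N - k) - f (N - k)) :=
    sum_nonneg fun k _ => mul_nonneg (hf k) (sub_nonneg.2 (hfa _))
  have hmid1 : ∑ k ∈ Ico K (N + 1 - K), f k * (a (N - k) - f (N - k)) ≤
      ∑ k ∈ Ico K (N + 1 - K), a k * a (N - k) :=
    sum_le_sum fun k _ => mul_le_mul (hfa k) (by linarith [hf (N - k)])
      (sub_nonneg.2 (hfa _)) (ha k).le
  rw [abs_lt] at h1
  rw [abs_le] at herr ⊢
  have e1 := mul_lt_mul_of_pos_right h1.1 hp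
  have e2 := mul_lt_mul_of_pos_right h1.2 hp
  have e3 := mul_lt_mul_of_pos_right h2 hp
  have e4 := mul_lt_mul_of_pos_left (mul_lt_mul_of_pos_right h3 hp) hδ
  have e5 := mul_pos hδ hp
  constructor <;> linarith

theorem tendsto_div_of_convolution {a f : ℕ → ℝ} {L Φ : ℝ} (ha : ∀ n, 0 < a n)
    (hf : ∀ n, 0 ≤ f n) (hfa : ∀ n, f n ≤ a n)
    (hr : Tendsto (fun n => a (n + 1) / a n) atTop (𝓝 1))
    (hsa : HasSum a (1 / 2)) (hsf : HasSum f Φ)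
    (hca : ∀ n, a (n + 1) = ∑ k ∈ range (n + 1), a k * a (n - k))
    (hcf : ∀ n, f (n + 1) = ∑ k ∈ range (n + 1), f k * (a (n - k) - f (n - k)))
    (hL : L = Φ + L * (1 / 2 - 2 * Φ)) :
    Tendsto (fun n => f n / a n) atTop (𝓝 L) := by
  have hpow : ∀ i : ℕ, ∀ᶠ n in atTop, |f n - L * a n| ≤ (3 / 4) ^ i * (1 + |L|) * a n := by
    intro i
    induction i with
    | zero =>
      refine Eventually.of_forall fun n => ?_
      have := abs_sub (f n) (L * a n)
      rw [abs_mul, abs_of_pos (ha n), abs_of_nonneg (hf n)] at this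
      linarith [hfa n]
    | succ i ih =>
      refine (eventually_abs_sub_le_of_convolution ha hf hfa hr hsa hsf hca hcf hL
        (by positivity) ih).mono fun n hn => hn.trans_eq ?_
      ring
  rw [Metric.tendsto_atTop']
  intro ε hε
  have h0 : Tendsto (fun i : ℕ => (3 / 4 : ℝ) ^ i * (1 + |L|)) atTop (𝓝 (0 * (1 + |L|))) :=
    (tendsto_pow_atTop_nhds_zero_of_lt_one (by norm_num) (by norm_num)).mul_const _
  rw [zero_mul] at h0
  obtain ⟨i, hi⟩ := (h0.eventually (gt_mem_nhds hε)).exists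
  obtain ⟨N, hN⟩ := eventually_atTop.1 (hpow i)
  refine ⟨N, fun n hn => ?_⟩
  have hp := ha n
  rw [Real.dist_eq, show f n / a n - L = (f n - L * a n) / a n by field_simp, abs_div,
    abs_of_pos hp, div_lt_iff₀ hp]
  exact (hN n hn.le).trans_lt (mul_lt_mul_of_pos_right hi hp)

/-- The total mass of a convergent solution of a convolution recurrence. -/
theorem HasSum.eq_add_mul_of_convolution {u v w : ℕ → ℝ} {U V W : ℝ} (hu : HasSum u U)
    (hv : HasSum v V) (hw : HasSum w W)
    (h : ∀ n, u (n + 1) = ∑ k ∈ range (n + 1), v k * w (n - k)) : U = u 0 + V * W := by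
  have h1 := hasSum_sum_range_mul_of_summable_norm hv.summable.norm hw.summable.norm
  rw [hv.tsum_eq, hw.tsum_eq] at h1
  simp_rw [← h] at h1
  have h2 := (hasSum_nat_add_iff' 1).2 hu
  rw [sum_range_one] at h2
  linarith [h1.unique h2]

/-! ### Scaled Catalan numbers -/

/-- The coefficients of `(1 - √(1 - x)) / 2`, without the constant term. -/
noncomputable def scaledCatalan (n : ℕ) : ℝ := catalan n / 4 ^ (n + 1)

theorem catalan_eq_centralBinom_div_real (n : ℕ) :
    (catalan n : ℝ) = n.centralBinom / (n + 1) := by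
  rw [eq_div_iff (by positivity), mul_comm]
  exact_mod_cast succ_mul_catalan_eq_centralBinom n

theorem succ_mul_centralBinom_succ_real (n : ℕ) :
    ((n + 1).centralBinom : ℝ) = 2 * (2 * n + 1) * n.centralBinom / (n + 1) := by
  rw [eq_div_iff (by positivity), mul_comm]
  exact_mod_cast Nat.succ_mul_centralBinom_succ n

theorem scaledCatalan_pos (n : ℕ) : 0 < scaledCatalan n := by
  have h := catalan_eq_centralBinom_div_real n
  have : (0 : ℝ) < n.centralBinom := by exact_mod_cast n.centralBinom_pos
  rw [scaledCatalan, h]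
  positivity

theorem scaledCatalan_zero : scaledCatalan 0 = 1 / 4 := by simp [scaledCatalan]

theorem scaledCatalan_succ (n : ℕ) :
    scaledCatalan (n + 1) = ∑ k ∈ range (n + 1), scaledCatalan k * scaledCatalan (n - k) := by
  unfold scaledCatalan
  rw [catalan_succ, Fin.sum_univ_eq_sum_range (fun k => catalan k * catalan (n - k)) n.succ]
  push_cast
  rw [sum_div]
  refine sum_congr rfl fun k hk => ?_
  rw [mem_range] at hk
  rw [div_mul_div_comm, ← pow_add, show k + 1 + (n - k + 1) = n + 1 + 1 by omega]

theorem sum_range_scaledCatalan (n : ℕ) :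
    ∑ k ∈ range n, scaledCatalan k = 1 / 2 - n.centralBinom / (2 * 4 ^ n) := by
  induction n with
  | zero => simp
  | succ n ih =>
    rw [sum_range_succ, ih, scaledCatalan, catalan_eq_centralBinom_div_real,
      succ_mul_centralBinom_succ_real]
    field_simp
    ring

theorem hasSum_scaledCatalan : HasSum scaledCatalan (1 / 2) := by
  have hs : Summable scaledCatalan := by
    refine summable_of_sum_range_le (c := 1 / 2) (fun n => (scaledCatalan_pos n).le) fun n => ?_
    rw [sum_range_scaledCatalan]
    have : (0 : ℝ) ≤ n.centralBinom / (2 * 4 ^ n) := by positivity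
    linarith
  obtain ⟨s, h⟩ := hs
  -- The sum solves `s = 1/4 + s ^ 2`, which has the double root `1/2`.
  have h1 := HasSum.eq_add_mul_of_convolution h h h scaledCatalan_succ
  rw [scaledCatalan_zero] at h1
  have h2 : s - 1 / 2 = 0 := pow_eq_zero_iff two_ne_zero |>.1 (by linarith : (s - 1 / 2) ^ 2 = 0)
  rwa [sub_eq_zero.1 h2] at h

theorem tendsto_scaledCatalan_succ_div :
    Tendsto (fun n => scaledCatalan (n + 1) / scaledCatalan n) atTop (𝓝 1) := by
  have h : ∀ n : ℕ, 1 - 3 / 2 * (1 / ((n + 1 : ℕ) + 1 : ℝ)) =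
      scaledCatalan (n + 1) / scaledCatalan n := by
    intro n
    have : (n.centralBinom : ℝ) ≠ 0 := by exact_mod_cast n.centralBinom_pos.ne'
    unfold scaledCatalan
    rw [catalan_eq_centralBinom_div_real, catalan_eq_centralBinom_div_real,
      succ_mul_centralBinom_succ_real]
    push_cast
    field_simp
    ring
  refine Tendsto.congr h ?_
  have := (((tendsto_add_atTop_iff_nat 1).2
    (tendsto_one_div_add_atTop_nhds_zero_nat (𝕜 := ℝ))).const_mul (3 / 2)).const_sub 1
  simpa using this

/-! ### Counting zeros of bracketings -/

namespace GodelChain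

/-- With `2 ≤ m` the top value differs from `0`, so a zero can only come from the branch `p > q`. -/
theorem godelImp_eq_zero_iff {m : ℕ} (hm : 2 ≤ m) (p q : Fin m) :
    (godelImp p q : ℕ) = 0 ↔ (p : ℕ) ≠ 0 ∧ (q : ℕ) = 0 := by
  unfold godelImp
  split_ifs with h
  · rw [Fin.le_def] at h
    simp only
    omega
  · rw [Fin.le_def] at h
    omega

theorem card_eval_eq_zero_node {m : ℕ} (hm : 2 ≤ m) (u : Unit) (l r : BinaryTree Unit) :
    (univ.filter fun ν : Fin (BinaryTree.node u l r).numLeaves → Fin m =>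
        (eval (BinaryTree.node u l r) ν : ℕ) = 0).card =
      (univ.filter fun ν : Fin l.numLeaves → Fin m => (eval l ν : ℕ) ≠ 0).card *
        (univ.filter fun ν : Fin r.numLeaves → Fin m => (eval r ν : ℕ) = 0).card := by
  rw [← card_product]
  refine card_equiv (Fin.appendEquiv l.numLeaves r.numLeaves).symm fun ν => ?_
  simp only [mem_filter, mem_univ, true_and, mem_product]
  exact godelImp_eq_zero_iff hm _ _

theorem card_eval_ne_zero {m : ℕ} (t : BinaryTree Unit) :
    ((univ.filter fun ν : Fin t.numLeaves → Fin m => (eval t ν : ℕ) ≠ 0).card : ℝ) =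
      (m : ℝ) ^ t.numLeaves -
        (univ.filter fun ν : Fin t.numLeaves → Fin m => (eval t ν : ℕ) = 0).card := by
  have h := card_filter_add_card_filter_not (s := (univ : Finset (Fin t.numLeaves → Fin m)))
    (fun ν => (eval t ν : ℕ) = 0)
  rw [card_univ, Fintype.card_fun, Fintype.card_fin, Fintype.card_fin] at h
  rw [eq_sub_iff_add_eq, add_comm]
  exact_mod_cast h

theorem totalCount_succ (m n : ℕ) : totalCount m (n + 1) = m ^ (n + 1) * catalan n := by
  unfold totalCount outputCount
  rw [sum_comm, ← BinaryTree.treesOfNumNodesEq_card_eq_catalan, mul_comm, ← smul_eq_mul,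
    ← sum_const]
  refine sum_congr rfl fun t ht => ?_
  rw [← (mem_fullBracketings t (n + 1)).1 ht,
    ← card_eq_sum_card_fiberwise (fun ν _ => by simp)]
  simp

theorem outputCount_zero_le (m n : ℕ) (hm : 2 ≤ m) : outputCount m n 0 ≤ totalCount m n :=
  single_le_sum (f := fun j => outputCount m n j) (fun _ _ => Nat.zero_le _)
    (mem_range.2 (by omega))

theorem outputCount_one {m : ℕ} (hm : 2 ≤ m) : outputCount m 1 0 = 1 := by
  change ∑ t ∈ BinaryTree.treesOfNumNodesEq 0, _ = 1
  rw [BinaryTree.treesOfNumNodesEq_zero, sum_singleton]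
  rw [card_eq_one]
  refine ⟨fun _ => ⟨0, by omega⟩, ?_⟩
  ext ν
  simp only [mem_filter, mem_univ, true_and, mem_singleton]
  constructor
  · intro h
    funext i
    have hi : i = ⟨0, Nat.one_pos⟩ := Fin.ext (Nat.lt_one_iff.1 i.2)
    rw [hi]
    exact Fin.ext h
  · rintro rfl
    rfl

theorem sum_treesOfNumNodesEq_succ {M : Type*} [AddCommMonoid M] (φ : BinaryTree Unit → M)
    (n : ℕ) :
    ∑ t ∈ BinaryTree.treesOfNumNodesEq (n + 1), φ t =
      ∑ k ∈ range (n + 1), ∑ l ∈ BinaryTree.treesOfNumNodesEq k,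
        ∑ r ∈ BinaryTree.treesOfNumNodesEq (n - k), φ (.node () l r) := by
  rw [BinaryTree.treesOfNumNodesEq_succ, sum_biUnion]
  · simp_rw [sum_map, sum_product]
    exact Finset.Nat.sum_antidiagonal_eq_sum_range_succ (fun i j =>
      ∑ l ∈ BinaryTree.treesOfNumNodesEq i, ∑ r ∈ BinaryTree.treesOfNumNodesEq j,
        φ (.node () l r)) n
  · simp_rw [Set.PairwiseDisjoint, Set.Pairwise, disjoint_left]
    aesop

theorem outputCount_succ_succ {m : ℕ} (hm : 2 ≤ m) (n : ℕ) :
    (outputCount m (n + 2) 0 : ℝ) = ∑ k ∈ range (n + 1),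
      ((m : ℝ) ^ (k + 1) * catalan k - outputCount m (k + 1) 0) *
        outputCount m (n - k + 1) 0 := by
  simp only [outputCount, fullBracketings]
  rw [sum_treesOfNumNodesEq_succ]
  push_cast
  refine sum_congr rfl fun k _ => ?_
  have h : (m : ℝ) ^ (k + 1) * catalan k =
      ∑ t ∈ BinaryTree.treesOfNumNodesEq k, (m : ℝ) ^ t.numLeaves := by
    rw [← BinaryTree.treesOfNumNodesEq_card_eq_catalan, mul_comm, ← nsmul_eq_mul, ← sum_const]
    refine sum_congr rfl fun t ht => ?_
    rw [(mem_fullBracketings t (k + 1)).1 ht]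
  rw [h, ← sum_sub_distrib, sum_mul_sum]
  refine sum_congr rfl fun l _ => sum_congr rfl fun r _ => ?_
  rw [card_eval_eq_zero_node hm, Nat.cast_mul, card_eval_ne_zero]

end GodelChain

/-! ### The limit of the ratio -/

namespace GodelChain

/-- The proportion limit, as a function of the number of truth values. -/
noncomputable def bottomLimit (m : ℕ) : ℝ := 1 / 2 * (1 - √((m : ℝ) / ((m : ℝ) + 4)))

/-- `g_{n+1}^{(0)} / (4 m)^{n+1}`. -/
noncomputable def scaledOutputCount (m n : ℕ) : ℝ :=
  (outputCount m (n + 1) 0 : ℝ) / ((m : ℝ) ^ (n + 1) * 4 ^ (n + 1))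

theorem scaledOutputCount_zero {m : ℕ} (hm : 2 ≤ m) :
    scaledOutputCount m 0 = 1 / (4 * m) := by
  simp [scaledOutputCount, outputCount_one hm, mul_comm]

theorem scaledOutputCount_succ {m : ℕ} (hm : 2 ≤ m) (n : ℕ) :
    scaledOutputCount m (n + 1) = ∑ k ∈ range (n + 1),
      scaledOutputCount m k * (scaledCatalan (n - k) - scaledOutputCount m (n - k)) := by
  have hm0 : (m : ℝ) ≠ 0 := by
    have : m ≠ 0 := by omega
    exact_mod_cast this
  rw [← sum_flip]
  unfold scaledOutputCount scaledCatalan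
  rw [outputCount_succ_succ hm, sum_div]
  refine sum_congr rfl fun k hk => ?_
  obtain ⟨j, rfl⟩ := Nat.exists_eq_add_of_le (Nat.lt_succ_iff.1 (mem_range.1 hk))
  rw [show k + j - k = j by omega, show k + j - j = k by omega]
  field_simp
  ring

theorem scaledOutputCount_nonneg (m n : ℕ) : 0 ≤ scaledOutputCount m n := by
  unfold scaledOutputCount
  positivity

theorem scaledOutputCount_le {m : ℕ} (hm : 2 ≤ m) (n : ℕ) :
    scaledOutputCount m n ≤ scaledCatalan n := by
  have hm0 : (0 : ℝ) < m := by
    have : 0 < m := by omega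
    exact_mod_cast this
  have h := outputCount_zero_le m (n + 1) hm
  rw [totalCount_succ] at h
  unfold scaledOutputCount scaledCatalan
  rw [← mul_div_mul_left (catalan n : ℝ) _ (pow_pos hm0 (n + 1)).ne']
  gcongr
  exact_mod_cast h

theorem bottomRatio_succ {m : ℕ} (hm : 2 ≤ m) (n : ℕ) :
    bottomRatio m (n + 1) = scaledOutputCount m n / scaledCatalan n := by
  have hm0 : (m : ℝ) ≠ 0 := by
    have : m ≠ 0 := by omega
    exact_mod_cast this
  unfold bottomRatio scaledOutputCount scaledCatalan
  rw [totalCount_succ, div_div_div_eq, mul_comm, ← div_div_div_eq]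
  push_cast
  have : (catalan n : ℝ) ≠ 0 := fun h => (scaledCatalan_pos n).ne' (by simp [scaledCatalan, h])
  field_simp

/-- Completing the square gives `(1 + 4 * Φ) ^ 2 = (m + 4) / m`. As `0 ≤ Φ` fixes the root, the
closed form becomes `2 * Φ / (1 + 4 * Φ)`, the solution of the linear equation for `L`. -/
theorem bottomLimit_eq_of_fixedPoint {m : ℕ} (hm : 2 ≤ m) {Φ : ℝ} (h0 : 0 ≤ Φ)
    (h : Φ = 1 / (4 * m) + Φ * (1 / 2 - Φ)) :
    bottomLimit m = Φ + bottomLimit m * (1 / 2 - 2 * Φ) := by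
  have hm0 : (0 : ℝ) < m := by
    have : 0 < m := by omega
    exact_mod_cast this
  have hq : (m : ℝ) * (1 + 4 * Φ) ^ 2 = m + 4 := by
    field_simp at h
    linarith
  have hs : √((m : ℝ) / (m + 4)) = 1 / (1 + 4 * Φ) := by
    rw [← hq, Real.sqrt_eq_iff_mul_self_eq (by positivity) (by positivity)]
    field_simp
  rw [bottomLimit, hs]
  field_simp
  ring

theorem tendsto_bottomRatio {m : ℕ} (hm : 2 ≤ m) :
    Tendsto (bottomRatio m) atTop (𝓝 (bottomLimit m)) := by
  rw [← tendsto_add_atTop_iff_nat 1]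
  simp_rw [bottomRatio_succ hm]
  obtain ⟨Φ, hΦ⟩ := Summable.of_nonneg_of_le (scaledOutputCount_nonneg m)
    (scaledOutputCount_le hm) hasSum_scaledCatalan.summable
  have h := HasSum.eq_add_mul_of_convolution hΦ hΦ (hasSum_scaledCatalan.sub hΦ)
    (scaledOutputCount_succ hm)
  rw [scaledOutputCount_zero hm] at h
  exact tendsto_div_of_convolution scaledCatalan_pos (scaledOutputCount_nonneg m)
    (scaledOutputCount_le hm) tendsto_scaledCatalan_succ_div hasSum_scaledCatalan hΦ
    scaledCatalan_succ (scaledOutputCount_succ hm)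
    (bottomLimit_eq_of_fixedPoint hm (hΦ.nonneg (scaledOutputCount_nonneg m)) h)

theorem pBot_eq {m : ℕ} (hm : 2 ≤ m) : pBot m = bottomLimit m :=
  (tendsto_bottomRatio hm).limUnder_eq

/-! ### The derivative formula and large `m` -/

theorem hasDerivAt_psi {x : ℝ} (hx : 0 < x) (v : ℝ) :
    HasDerivAt (psi x) ((1 + (1 - v) / √((1 - v) ^ 2 + 4 * x)) / 2) v := by
  have hp : (1 - v) ^ 2 + 4 * x ≠ 0 := by positivity
  have h := (((hasDerivAt_id v).const_add 1).sub
    (((((hasDerivAt_id v).const_sub 1).pow 2).add_const (4 * x)).sqrt hp)).div_const 2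
  refine h.congr_deriv ?_
  have hs : √((1 - v) ^ 2 + 4 * x) ≠ 0 := by positivity
  simp only [id, Nat.cast_ofNat, Pi.pow_apply]
  field_simp
  ring

theorem bottomLimit_eq_one_sub_psi_deriv {m : ℕ} (hm : 2 ≤ m) :
    bottomLimit m = 1 - (1 + (1 - 1 / 2) / √((1 - 1 / 2) ^ 2 + 4 * (1 / (4 * (m : ℝ))))) / 2 := by
  have hm0 : (0 : ℝ) < m := by
    have : 0 < m := by omega
    exact_mod_cast this
  have hs : √((m : ℝ) / (m + 4)) = (1 - 1 / 2) / √((1 - 1 / 2) ^ 2 + 4 * (1 / (4 * (m : ℝ)))) := by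
    rw [Real.sqrt_eq_iff_mul_self_eq (by positivity) (by positivity), div_mul_div_comm,
      Real.mul_self_sqrt (by positivity)]
    field_simp
    ring
  rw [bottomLimit, hs]
  ring

theorem tendsto_sqrt_div_add_four :
    Tendsto (fun m : ℕ => √((m : ℝ) / ((m : ℝ) + 4))) atTop (𝓝 1) := by
  simpa using (tendsto_natCast_div_add_atTop (4 : ℝ)).sqrt

theorem tendsto_mul_bottomLimit :
    Tendsto (fun m : ℕ => (m : ℝ) * bottomLimit m) atTop (𝓝 1) := by
  -- Multiplying by the conjugate `1 + s`, with `1 - s ^ 2 = 4 / (m + 4)`, turns the product into `2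
  -- * (m / (m + 4)) / (1 + s)`.
  have h := ((tendsto_natCast_div_add_atTop (4 : ℝ)).const_mul 2).div
    (tendsto_sqrt_div_add_four.const_add 1) (by norm_num)
  rw [show (2 * 1 / (1 + 1) : ℝ) = 1 by norm_num] at h
  refine h.congr fun m => ?_
  have hs := Real.sq_sqrt (show 0 ≤ (m : ℝ) / (m + 4) by positivity)
  have hp : 0 < 1 + √((m : ℝ) / (m + 4)) := by positivity
  have hd : (m : ℝ) / (m + 4) = 1 - 4 / (m + 4) := by field_simp; ring
  simp only [bottomLimit, Pi.div_apply]
  rw [div_eq_iff hp.ne']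
  set s := √((m : ℝ) / (m + 4))
  have : (m : ℝ) * (1 / 2 * (1 - s)) * (1 + s) = m / 2 * (1 - s ^ 2) := by ring
  rw [this, hs, hd]
  field_simp
  ring

theorem pBot_isEquivalent :
    Asymptotics.IsEquivalent atTop pBot (fun m : ℕ => 1 / (m : ℝ)) := by
  refine Asymptotics.isEquivalent_of_tendsto_one ?_
  refine tendsto_mul_bottomLimit.congr' ?_
  filter_upwards [eventually_ge_atTop 2] with m hm
  rw [Pi.div_apply, pBot_eq hm, div_div_eq_mul_div, div_one, mul_comm]

end GodelChain

theorem mainTheorem5 :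
    (∀ m : ℕ, 2 ≤ m →
      (∀ n : ℕ, 1 ≤ n → GodelChain.totalCount m n = m ^ n * catalan (n - 1)) ∧
      Filter.Tendsto (GodelChain.bottomRatio m) Filter.atTop (nhds (GodelChain.pBot m)) ∧
      GodelChain.pBot m = 1 / 2 * (1 - √((m : ℝ) / ((m : ℝ) + 4))) ∧
      DifferentiableAt ℝ (GodelChain.psi (1 / (4 * (m : ℝ)))) (1 / 2) ∧
      GodelChain.pBot m = 1 - deriv (GodelChain.psi (1 / (4 * (m : ℝ)))) (1 / 2)) ∧
    Asymptotics.IsEquivalent Filter.atTop GodelChain.pBot (fun m : ℕ => 1 / (m : ℝ)) ∧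
    Filter.Tendsto GodelChain.pBot Filter.atTop (nhds 0) := by
  refine ⟨fun m hm => ?_, GodelChain.pBot_isEquivalent,
    GodelChain.pBot_isEquivalent.symm.tendsto_nhds tendsto_one_div_atTop_nhds_zero_nat⟩
  have hm0 : (0 : ℝ) < m := by
    have : 0 < m := by omega
    exact_mod_cast this
  have hd := GodelChain.hasDerivAt_psi (x := 1 / (4 * (m : ℝ))) (by positivity) (1 / 2)
  refine ⟨fun n hn => ?_, ?_, GodelChain.pBot_eq hm, hd.differentiableAt, ?_⟩
  · obtain ⟨k, rfl⟩ := Nat.exists_eq_add_of_le' hn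
    exact GodelChain.totalCount_succ m k
  · rw [GodelChain.pBot_eq hm]
    exact GodelChain.tendsto_bottomRatio hm
  · rw [hd.deriv, GodelChain.pBot_eq hm]
    exact GodelChain.bottomLimit_eq_one_sub_psi_deriv hm
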